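/- Let $V$ be a finite-dimensional real Euclidean space with inner product $\langle\cdot,\cdot\rangle$, and for $0\neq\alpha\in V$ let $s_\alpha(v)=v-\frac{2\langle v,\alpha\rangle}{\langle\alpha,\alpha\rangle}\alpha$ be the orthogonal reflection in $\alpha$. Let $\Phi\subseteq V\setminus\{0\}$ be a crystallographic (reduced) root system: $\Phi$ is finite, $s_\alpha(\beta)\in\Phi$ and $\frac{2\langle\alpha,\beta\rangle}{\langle\beta,\beta\rangle}\in\mathbb Z$ for all $\alpha,\beta\in\Phi$, and $\alpha,c\alpha\in\Phi$ with $c\in\mathbb R$ implies $c=\pm1$. ($\Phi$ need not span $V$.) Let $\Pi$ be a simple system of $\Phi$, i.e. a linearly independent subset $\Pi\subseteq\Phi$ such that $\Phi$ is the disjoint union of $\Phi_+:=\Phi\cap\mathbb R_{\ge0}\Pi$ and $-\Phi_+$. Assume that the group $W$ generated by all $s_\alpha$, $\alpha\in\Phi$, is an irreducible Weyl group, i.e. the Coxeter graph of $(W,\{s_\alpha\mid\alpha\in\Pi\})$ is non-empty and connected. For $\gamma\in\Phi$ define the root coefficients $\gamma[\beta]\in\mathbb R$ ($\beta\in\Pi$)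 by $\gamma=\sum_{\beta\in\Pi}\gamma[\beta]\beta$. Fix $\Delta\subseteq\Pi$, scalars $c_\beta\in\mathbb R$ for $\beta\in\Delta$, not all zero, and $l\in\mathbb R$, and let $$X:=\{\gamma\in\Phi\mid \langle\gamma,\gamma\rangle^{1/2}=l\text{ and }\gamma[\beta]=c_\beta\text{ for all }\beta\in\Delta\}.$$ Let $W_{\Pi\setminus\Delta}$ be the standard parabolic subgroup generated by the $s_\alpha$ with $\alpha\in\Pi\setminus\Delta$, and let $\mathcal C_{\Pi\setminus\Delta}:=\{v\in V\mid\langle v,\alpha\rangle\ge0\text{ for all }\alpha\in\Pi\setminus\Delta\}$ be its closed fundamental chamber. If $X$ is non-empty, then $X$ is a single $W_{\Pi\setminus\Delta}$-orbit of roots. Equivalently, $|X\cap\mathcal C_{\Pi\setminus\Delta}|\le1$. -/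

import Mathlib

open scoped NNReal RealInnerProductSpace Pointwise

namespace EuclideanRoots

variable {V : Type*} [NormedAddCommGroup V] [InnerProductSpace ℝ V]

/-- The orthogonal reflection `s_α` of the Euclidean space `V` in the vector `α`
(that is, in the hyperplane orthogonal to `α`), as an element of `GL(V)`. -/
noncomputable def refl (α : V) : V ≃ₗ[ℝ] V :=
  ((Submodule.span ℝ {α})ᗮ.reflection).toLinearEquiv

/-- The usual formula `s_α(v) = v - (2⟨v, α⟩ / ⟨α, α⟩) α`. -/
theorem refl_apply (α v : V) :
    refl α v = v - (2 * ⟪v, α⟫ / ⟪α, α⟫) • α := by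
  have h : refl α v = (Submodule.span ℝ {α})ᗮ.reflection v := rfl
  rw [h, Submodule.reflection_orthogonal_apply, Submodule.reflection_singleton_apply,
    real_inner_self_eq_norm_sq, real_inner_comm]
  simp only [RCLike.ofReal_real_eq_id, id_eq, neg_sub, two_smul]
  rw [← add_smul]
  congr 2
  ring

/-- A (finite, reduced, not necessarily crystallographic, not necessarily spanning)
root system in the Euclidean space `V`. -/
structure IsRootSystem (Φ : Set V) : Prop where
  finite : Φ.Finite
  zero_notMem : (0 : V) ∉ Φ
  refl_mem : ∀ α ∈ Φ, ∀ β ∈ Φ, refl α β ∈ Φ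
  reduced : ∀ α ∈ Φ, ∀ c : ℝ, c • α ∈ Φ → c = 1 ∨ c = -1

/-- `Φ` is crystallographic: `⟨α, β^∨⟩ = 2⟨α, β⟩ / ⟨β, β⟩` is an integer for all roots `α, β`. -/
def IsCrystallographic (Φ : Set V) : Prop :=
  ∀ α ∈ Φ, ∀ β ∈ Φ, ∃ n : ℤ, 2 * ⟪α, β⟫ / ⟪β, β⟫ = (n : ℝ)

/-- The roots that are linear combinations of `B` with non-negative real coefficients. -/
def positiveRoots (Φ B : Set V) : Set V :=
  Φ ∩ (Submodule.span ℝ≥0 B : Set V)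

/-- `B` is a simple system of `Φ`: a linearly independent set of roots such that `Φ` is the
disjoint union of the positive roots and their negatives. -/
structure IsSimpleSystem (Φ B : Set V) : Prop where
  subset : B ⊆ Φ
  linearIndependent : LinearIndependent ℝ ((↑) : B → V)
  eq_union : Φ = positiveRoots Φ B ∪ -positiveRoots Φ B
  disjoint : Disjoint (positiveRoots Φ B) (-positiveRoots Φ B)

/-- The group generated by the reflections in the elements of `J`.  For `J = Φ` (equivalently
`J` a simple system) this is the reflection group `W` of `Φ`; for a subset `J` of a simple
system it is the standard parabolic subgroup `W_J` with simple roots `J`. -/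
def reflGroup (J : Set V) : Subgroup (V ≃ₗ[ℝ] V) :=
  Subgroup.closure (refl '' J)

/-- The Coxeter system `(W, S)`, `S = {s_α | α ∈ B}`, is irreducible: `S` is non-empty and is
not the union of two non-empty disjoint subsets that commute with one another
(i.e. the Coxeter graph is non-empty and connected). -/
def IsIrreducibleSystem (B : Set V) : Prop :=
  B.Nonempty ∧ ∀ I ⊆ B, I.Nonempty → (B \ I).Nonempty →
    ∃ α ∈ I, ∃ β ∈ B \ I, ¬ Commute (refl α) (refl β)

/-- The closed fundamental chamber of the reflection group with simple roots `J`. -/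
def chamber (J : Set V) : Set V :=
  {v | ∀ β ∈ J, 0 ≤ ⟪v, β⟫}

theorem span_nnreal_subset (B : Set V) {v : V} (hv : v ∈ Submodule.span ℝ≥0 B) :
    v ∈ Submodule.span ℝ B := by
  induction hv using Submodule.span_induction with
  | mem x h => exact Submodule.subset_span h
  | zero => exact zero_mem _
  | add x y _ _ hx hy => exact add_mem hx hy
  | smul a x _ hx => exact Submodule.smul_mem _ (a : ℝ) hx

theorem IsSimpleSystem.span_le {Φ B : Set V} (h : IsSimpleSystem Φ B) :
    Submodule.span ℝ Φ ≤ Submodule.span ℝ B := by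
  rw [Submodule.span_le]
  intro v hv
  rw [h.eq_union] at hv
  rcases hv with hv | hv
  · exact span_nnreal_subset B hv.2
  · have := span_nnreal_subset B (Set.mem_neg.mp hv).2
    simpa using neg_mem this

/-- The root coefficient `γ[β]` of `γ ∈ ℝΦ` at the simple root `β`: the coefficient of `β` in the
unique expression of `γ` as a linear combination of simple roots. -/
noncomputable def rootCoeff {Φ B : Set V} (h : IsSimpleSystem Φ B)
    (γ : Submodule.span ℝ Φ) (β : B) : ℝ :=
  h.linearIndependent.repr
    ⟨(γ : V), by rw [Subtype.range_coe]; exact h.span_le γ.2⟩ β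

/-- `γ = ∑_β γ[β] β` characterises the root coefficients. -/
theorem rootCoeff_eq_iff {Φ B : Set V} [Fintype B] (h : IsSimpleSystem Φ B)
    (γ : Submodule.span ℝ Φ) (a : B → ℝ) :
    rootCoeff h γ = a ↔ (γ : V) = ∑ β : B, a β • (β : V) := by
  have key : (γ : V) = ∑ β : B, rootCoeff h γ β • (β : V) := by
    have := h.linearIndependent.linearCombination_repr
      ⟨(γ : V), by rw [Subtype.range_coe]; exact h.span_le γ.2⟩
    rw [Finsupp.linearCombination_apply, Finsupp.sum_fintype _ _ (by simp)] at this
    exact this.symm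
  constructor
  · rintro rfl
    exact key
  · intro hγ
    have h0 := Fintype.linearIndependent_iff.mp h.linearIndependent
      (fun β => rootCoeff h γ β - a β) (by
        simp only [sub_smul, Finset.sum_sub_distrib]
        rw [← key, ← hγ, sub_self])
    funext β
    exact sub_eq_zero.mp (h0 β)

/-- The set `X` of roots of length `l` whose coefficient at each `β ∈ Δ` is `c_β`. -/
def rootsWithCoeffs {Φ B : Set V} (h : IsSimpleSystem Φ B) {Δ : Set V} (hΔ : Δ ⊆ B)
    (c : Δ → ℝ) (l : ℝ) : Set V :=
  {γ | ∃ hγ : γ ∈ Φ, ‖γ‖ = l ∧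
    ∀ β : Δ, rootCoeff h ⟨γ, Submodule.subset_span hγ⟩ ⟨(β : V), hΔ β.2⟩ = c β}

end EuclideanRoots

namespace EuclideanRoots

variable {V : Type*} [NormedAddCommGroup V] [InnerProductSpace ℝ V]

/-! Let `J = B \ Δ`. Suppose `γ ≠ γ'` are `J`-dominant roots in `X`. They differ by an element of
span `J`, so they share a component orthogonal to `J`, nonzero since some `c β ≠ 0`. Their
projections to span `J` are `J`-dominant, hence nonnegative combinations of `J` (simple roots being
pairwise non-acute), and so pair nonnegatively. Thus `⟪γ, γ'⟫ > 0`, and integrality with equal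
lengths makes `γ - γ'` a root, so its coefficients have one sign. Dominance then gives `⟪γ', γ - γ'⟫
≥ 0` or `⟪γ, γ' - γ⟫ ≥ 0`, against strict Cauchy–Schwarz
(`eq_of_mem_rootsWithCoeffs_of_mem_chamber`). Since `X` is finite and stable under the parabolic
subgroup, each orbit in it contains a dominant root; uniqueness of that root leaves one orbit. -/

theorem norm_refl (α v : V) : ‖refl α v‖ = ‖v‖ :=
  ((Submodule.span ℝ {α})ᗮ.reflection).norm_map v

/-- The root coefficients extend to linear functionals on the whole space. -/
theorem IsSimpleSystem.exists_coeff {Φ B : Set V} (h : IsSimpleSystem Φ B) :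
    ∃ F : V →ₗ[ℝ] (B →₀ ℝ),
      (∀ β : B, F β = Finsupp.single β 1) ∧
      (∀ v ∈ Submodule.span ℝ B, Finsupp.linearCombination ℝ ((↑) : B → V) (F v) = v) ∧
      ∀ (γ : Submodule.span ℝ Φ) (β : B), rootCoeff h γ β = F γ β := by
  -- `F` is arbitrary off the span of `B`; in return, it applies to any vector without a membership
  -- proof.
  obtain ⟨F, hF⟩ := LinearMap.exists_extend
    (h.linearIndependent.repr : Submodule.span ℝ (Set.range ((↑) : B → V)) →ₗ[ℝ] (B →₀ ℝ))
  have hF' (x : Submodule.span ℝ (Set.range ((↑) : B → V))) :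
      F x = h.linearIndependent.repr x := LinearMap.congr_fun hF x
  refine ⟨F, fun β => ?_, fun v hv => ?_, fun γ β => ?_⟩
  · have hβ : (β : V) ∈ Submodule.span ℝ (Set.range ((↑) : B → V)) :=
      Submodule.subset_span ⟨β, rfl⟩
    rw [hF' ⟨β, hβ⟩]
    exact h.linearIndependent.repr_eq_single β _ rfl
  · rw [← Subtype.range_coe (s := B)] at hv
    rw [hF' ⟨v, hv⟩]
    exact h.linearIndependent.linearCombination_repr ⟨v, hv⟩
  · have hγ : (γ : V) ∈ Submodule.span ℝ (Set.range ((↑) : B → V)) := by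
      rw [Subtype.range_coe]; exact h.span_le γ.2
    rw [hF' ⟨γ, hγ⟩]
    rfl

section Coefficients

variable {Φ B : Set V} {F : V →ₗ[ℝ] (B →₀ ℝ)}

theorem coeff_nonneg_of_mem_span (hF : ∀ β : B, F β = Finsupp.single β 1) {v : V}
    (hv : v ∈ Submodule.span ℝ≥0 B) (β : B) : 0 ≤ F v β := by
  classical
  induction hv using Submodule.span_induction with
  | mem x h =>
    rw [hF ⟨x, h⟩, Finsupp.single_apply]
    split_ifs <;> norm_num
  | zero => simp
  | add x y _ _ hx hy => rw [map_add, Finsupp.add_apply]; exact add_nonneg hx hy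
  | smul a x _ hx =>
    have : F (a • x) = (a : ℝ) • F x := map_smul F (a : ℝ) x
    rw [this, Finsupp.smul_apply]
    exact mul_nonneg a.2 hx

theorem IsSimpleSystem.coeff_nonneg_or_nonpos (h : IsSimpleSystem Φ B)
    (hF : ∀ β : B, F β = Finsupp.single β 1) {v : V} (hv : v ∈ Φ) :
    (∀ β, 0 ≤ F v β) ∨ ∀ β, F v β ≤ 0 := by
  rw [h.eq_union] at hv
  rcases hv with hv | hv
  · exact Or.inl (coeff_nonneg_of_mem_span hF hv.2)
  · refine Or.inr fun β => ?_
    have := coeff_nonneg_of_mem_span hF (Set.mem_neg.mp hv).2 β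
    rw [map_neg, Finsupp.neg_apply] at this
    linarith

theorem mem_span_of_coeff_eq_zero {J : Set V} {v : V}
    (hv : Finsupp.linearCombination ℝ ((↑) : B → V) (F v) = v)
    (h0 : ∀ β : B, (β : V) ∉ J → F v β = 0) : v ∈ Submodule.span ℝ J := by
  rw [← hv, Finsupp.linearCombination_apply]
  refine Submodule.sum_mem _ fun β _ => ?_
  by_cases hβ : (β : V) ∈ J
  · exact Submodule.smul_mem _ _ (Submodule.subset_span hβ)
  · simp [h0 β hβ]

theorem coeff_eq_zero_of_mem_span (hF : ∀ β : B, F β = Finsupp.single β 1) {J : Set V}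
    (hJ : J ⊆ B) {v : V} (hv : v ∈ Submodule.span ℝ J) {β : B} (hβ : (β : V) ∉ J) :
    F v β = 0 := by
  classical
  induction hv using Submodule.span_induction with
  | mem x h =>
    rw [hF ⟨x, hJ h⟩, Finsupp.single_apply, if_neg]
    rintro rfl
    exact hβ h
  | zero => simp
  | add x y _ _ hx hy => rw [map_add, Finsupp.add_apply, hx, hy, add_zero]
  | smul a x _ hx => rw [map_smul, Finsupp.smul_apply, hx, smul_zero]

theorem inner_nonneg_of_coeff_nonneg {J : Set V} (hJ : J ⊆ B)
    (hF : ∀ β : B, F β = Finsupp.single β 1)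
    (hspan : ∀ v ∈ Submodule.span ℝ B, Finsupp.linearCombination ℝ ((↑) : B → V) (F v) = v)
    {v w : V} (hv : v ∈ Submodule.span ℝ J) (hpos : ∀ β, 0 ≤ F v β) (hw : w ∈ chamber J) :
    0 ≤ ⟪w, v⟫ := by
  rw [← hspan v (Submodule.span_mono hJ hv), Finsupp.linearCombination_apply, Finsupp.sum,
    inner_sum]
  refine Finset.sum_nonneg fun β _ => ?_
  rw [inner_smul_right]
  by_cases hβ : (β : V) ∈ J
  · exact mul_nonneg (hpos β) (hw β hβ)
  · rw [coeff_eq_zero_of_mem_span hF hJ hv hβ, zero_mul]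

end Coefficients

/-! ### Angles between simple roots and dominant vectors -/

/-- Distinct simple roots form an obtuse or right angle. -/
theorem IsSimpleSystem.inner_nonpos {Φ B : Set V} (hΦ : IsRootSystem Φ)
    (h : IsSimpleSystem Φ B) {α β : B} (hne : α ≠ β) : ⟪(α : V), β⟫ ≤ 0 := by
  obtain ⟨F, hF, -, -⟩ := h.exists_coeff
  have hmem := hΦ.refl_mem β (h.subset β.2) α (h.subset α.2)
  have hβ0 : (β : V) ≠ 0 := fun h0 => hΦ.zero_notMem (h0 ▸ h.subset β.2)
  have hpos : 0 < ⟪(β : V), (β : V)⟫ := real_inner_self_pos.mpr hβ0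
  have hcoeff : F (refl (β : V) (α : V)) =
      Finsupp.single α 1 - (2 * ⟪(α : V), β⟫ / ⟪(β : V), (β : V)⟫) • Finsupp.single β 1 := by
    rw [refl_apply, map_sub, map_smul, hF, hF]
  -- The reflected root has coefficient 1 at `α`, so its coefficient at `β` cannot be negative.
  have hα1 : F (refl (β : V) (α : V)) α = 1 := by
    rw [hcoeff]; simp [hne.symm]
  have hβ1 : F (refl (β : V) (α : V)) β = -(2 * ⟪(α : V), β⟫ / ⟪(β : V), (β : V)⟫) := by
    rw [hcoeff]; simp [hne]
  by_contra! hlt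
  have : 0 < 2 * ⟪(α : V), β⟫ / ⟪(β : V), (β : V)⟫ := by positivity
  rcases h.coeff_nonneg_or_nonpos hF hmem with h' | h'
  · linarith [h' β]
  · linarith [h' α]

/-- A vector in the span of `J` that is dominant for `J` is a non-negative combination of `J`. -/
theorem coeff_nonneg_of_mem_chamber {Φ B : Set V} (hΦ : IsRootSystem Φ)
    (h : IsSimpleSystem Φ B) {F : V →ₗ[ℝ] (B →₀ ℝ)} (hF : ∀ β : B, F β = Finsupp.single β 1)
    (hspan : ∀ v ∈ Submodule.span ℝ B, Finsupp.linearCombination ℝ ((↑) : B → V) (F v) = v)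
    {J : Set V} (hJ : J ⊆ B) {v : V} (hv : v ∈ Submodule.span ℝ J) (hdom : v ∈ chamber J)
    (β : B) : 0 ≤ F v β := by
  classical
  have hfin : Finite B := (hΦ.finite.subset h.subset).to_subtype
  have : Fintype B := Fintype.ofFinite B
  have hsum : v = ∑ β : B, F v β • (β : V) := by
    have := hspan v (Submodule.span_mono hJ hv)
    rw [Finsupp.linearCombination_apply, Finsupp.sum_fintype _ _ (by simp)] at this
    exact this.symm
  -- Write `v = p - q` with `p`, `q` nonnegative of disjoint support. Then `0 ≤ ⟪v, q⟫ = ⟪p, q⟫ -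
  -- ⟪q, q⟫ ≤ -⟪q, q⟫` forces `q = 0`.
  set q : V := ∑ β : B, (F v β)⁻ • (β : V) with hq
  set p : V := ∑ β : B, (F v β)⁺ • (β : V) with hp
  have hvpq : v = p - q := by
    rw [hp, hq, ← Finset.sum_sub_distrib]
    simp_rw [← sub_smul, posPart_sub_negPart]
    exact hsum
  have hvq : 0 ≤ ⟪v, q⟫ := by
    rw [hq, inner_sum]
    refine Finset.sum_nonneg fun β _ => ?_
    rw [inner_smul_right]
    by_cases hβ : (β : V) ∈ J
    · exact mul_nonneg (negPart_nonneg _) (hdom β hβ)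
    · rw [coeff_eq_zero_of_mem_span hF hJ hv hβ]; simp
  have hpq : ⟪p, q⟫ ≤ 0 := by
    rw [hp, hq, sum_inner]
    refine Finset.sum_nonpos fun α _ => ?_
    rw [inner_sum]
    refine Finset.sum_nonpos fun β _ => ?_
    rw [inner_smul_left, inner_smul_right, conj_trivial]
    by_cases hαβ : α = β
    · subst hαβ
      rcases le_total 0 (F v α) with hα | hα
      · simp [negPart_eq_zero.mpr hα]
      · simp [posPart_eq_zero.mpr hα]
    · exact mul_nonpos_of_nonneg_of_nonpos (posPart_nonneg _)
        (mul_nonpos_of_nonneg_of_nonpos (negPart_nonneg _) (h.inner_nonpos hΦ hαβ))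
  have hq0 : q = 0 := by
    rw [hvpq, inner_sub_left] at hvq
    exact real_inner_self_nonpos.mp (by linarith)
  have := Fintype.linearIndependent_iff.mp h.linearIndependent (fun β => (F v β)⁻) hq0 β
  exact negPart_eq_zero.mp this

/-! ### Uniqueness of the dominant root -/

/-- The difference of two distinct roots of equal length at an acute angle is a root. -/
theorem sub_mem_of_inner_pos {Φ : Set V} (hΦ : IsRootSystem Φ) (hcrys : IsCrystallographic Φ)
    {γ γ' : V} (hγ : γ ∈ Φ) (hγ' : γ' ∈ Φ) (hnorm : ‖γ‖ = ‖γ'‖) (hne : γ ≠ γ')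
    (hpos : 0 < ⟪γ, γ'⟫) : γ - γ' ∈ Φ := by
  obtain ⟨n, hn⟩ := hcrys γ hγ γ' hγ'
  have h0 : γ' ≠ 0 := fun h => hΦ.zero_notMem (h ▸ hγ')
  have hself : 0 < ⟪γ', γ'⟫ := real_inner_self_pos.mpr h0
  -- Strictness places the Cartan integer strictly between 0 and 2.
  have hlt : ⟪γ, γ'⟫ < ⟪γ', γ'⟫ := by
    have h1 : 0 < ‖γ - γ'‖ ^ 2 := by
      have := norm_pos_iff.mpr (sub_ne_zero.mpr hne)
      positivity
    rw [norm_sub_sq_real, hnorm] at h1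
    rw [real_inner_self_eq_norm_sq]
    linarith
  have hn0 : (0 : ℝ) < n := by rw [← hn]; positivity
  have hn2 : (n : ℝ) < 2 := by rw [← hn, div_lt_iff₀ hself]; linarith
  have hn1 : n = 1 := by
    have h1 : 0 < n := by exact_mod_cast hn0
    have h2 : n < 2 := by exact_mod_cast hn2
    omega
  have := hΦ.refl_mem γ' hγ' γ hγ
  rwa [refl_apply, hn, hn1, Int.cast_one, one_smul] at this

/-- Two `J`-dominant vectors congruent modulo the span of `J`, not lying in that span, form an
acute angle. -/
theorem inner_pos_of_mem_chamber [FiniteDimensional ℝ V] {Φ B : Set V} (hΦ : IsRootSystem Φ)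
    (h : IsSimpleSystem Φ B) {J : Set V} (hJ : J ⊆ B) {γ γ' : V}
    (hsub : γ - γ' ∈ Submodule.span ℝ J) (hγ : γ ∉ Submodule.span ℝ J)
    (hdom : γ ∈ chamber J) (hdom' : γ' ∈ chamber J) : 0 < ⟪γ, γ'⟫ := by
  obtain ⟨F, hF, hspan, -⟩ := h.exists_coeff
  set K := Submodule.span ℝ J
  have hperp (v : V) : v - K.starProjection v ∈ Kᗮ := K.sub_starProjection_mem_orthogonal v
  have hK (v : V) : K.starProjection v ∈ K := K.starProjection_apply_mem v
  have hdomK {v : V} (hv : v ∈ chamber J) : K.starProjection v ∈ chamber J := fun β hβ => by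
    have := K.inner_left_of_mem_orthogonal (Submodule.subset_span hβ) (hperp v)
    rw [inner_sub_left] at this
    linarith [hv β hβ]
  have hcongr : γ' - K.starProjection γ' = γ - K.starProjection γ := by
    have := Submodule.starProjection_eq_self_iff.mpr hsub
    rw [map_sub] at this
    rw [sub_eq_sub_iff_sub_eq_sub, ← neg_sub γ γ', ← this, neg_sub]
  have hu : γ - K.starProjection γ ≠ 0 := fun h0 => hγ (sub_eq_zero.mp h0 ▸ hK γ)
  have hupos := real_inner_self_pos.mpr hu
  have hproj : 0 ≤ ⟪K.starProjection γ, K.starProjection γ'⟫ :=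
    inner_nonneg_of_coeff_nonneg hJ hF hspan (hK γ')
      (coeff_nonneg_of_mem_chamber hΦ h hF hspan hJ (hK γ') (hdomK hdom')) (hdomK hdom)
  have h1 : ⟪γ - K.starProjection γ, K.starProjection γ'⟫ = 0 :=
    K.inner_left_of_mem_orthogonal (hK γ') (hperp γ)
  have h2 : ⟪K.starProjection γ, γ - K.starProjection γ⟫ = 0 :=
    K.inner_right_of_mem_orthogonal (hK γ) (hperp γ)
  have hdec' : γ' = (γ - K.starProjection γ) + K.starProjection γ' := by
    rw [← hcongr, sub_add_cancel]
  have hdec : ⟪γ, γ'⟫ = ⟪(γ - K.starProjection γ) + K.starProjection γ,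
      (γ - K.starProjection γ) + K.starProjection γ'⟫ := by
    rw [← hdec', sub_add_cancel]
  rw [hdec, inner_add_left, inner_add_right, inner_add_right, h1, h2]
  linarith

theorem rootsWithCoeffs_subset {Φ B : Set V} (h : IsSimpleSystem Φ B) {Δ : Set V} (hΔ : Δ ⊆ B)
    (c : Δ → ℝ) (l : ℝ) : rootsWithCoeffs h hΔ c l ⊆ Φ := fun _ hγ => hγ.1

/-- At most one root of given length with prescribed, not all zero, coefficients is dominant for
the remaining simple roots. -/
theorem eq_of_mem_rootsWithCoeffs_of_mem_chamber [FiniteDimensional ℝ V] {Φ B : Set V}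
    (hΦ : IsRootSystem Φ) (hcrys : IsCrystallographic Φ) (h : IsSimpleSystem Φ B)
    {Δ : Set V} (hΔ : Δ ⊆ B) {c : Δ → ℝ} (hc : ∃ β : Δ, c β ≠ 0) {l : ℝ} {γ γ' : V}
    (hγ : γ ∈ rootsWithCoeffs h hΔ c l) (hγ' : γ' ∈ rootsWithCoeffs h hΔ c l)
    (hdom : γ ∈ chamber (B \ Δ)) (hdom' : γ' ∈ chamber (B \ Δ)) : γ = γ' := by
  obtain ⟨F, hF, hspan, hroot⟩ := h.exists_coeff
  obtain ⟨hΦγ, hl, hcγ⟩ := hγ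
  obtain ⟨hΦγ', hl', hcγ'⟩ := hγ'
  have hJ : B \ Δ ⊆ B := Set.sdiff_subset
  by_contra hne
  have hmemB {v : V} (hv : v ∈ Φ) : v ∈ Submodule.span ℝ B :=
    h.span_le (Submodule.subset_span hv)
  have hsub : γ - γ' ∈ Submodule.span ℝ (B \ Δ) := by
    refine mem_span_of_coeff_eq_zero (hspan _ (sub_mem (hmemB hΦγ) (hmemB hΦγ')))
      fun β hβ => ?_
    have hβΔ : (β : V) ∈ Δ := by
      by_contra hn
      exact hβ ⟨β.2, hn⟩
    have e := hcγ ⟨β, hβΔ⟩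
    have e' := hcγ' ⟨β, hβΔ⟩
    rw [hroot] at e e'
    rw [map_sub, Finsupp.sub_apply]
    exact sub_eq_zero.mpr (e.trans e'.symm)
  have hnot : γ ∉ Submodule.span ℝ (B \ Δ) := by
    intro hmem
    obtain ⟨β, hβ⟩ := hc
    refine hβ ?_
    rw [← hcγ β, hroot]
    exact coeff_eq_zero_of_mem_span hF hJ hmem fun hβ' => hβ'.2 β.2
  have hnorm : ‖γ‖ = ‖γ'‖ := hl.trans hl'.symm
  have hδ := sub_mem_of_inner_pos hΦ hcrys hΦγ hΦγ' hnorm hne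
    (inner_pos_of_mem_chamber hΦ h hJ hsub hnot hdom hdom')
  have hlt : ⟪γ, γ'⟫ < ‖γ'‖ ^ 2 := by
    have h1 := norm_pos_iff.mpr (sub_ne_zero.mpr hne)
    have h2 : 0 < ‖γ - γ'‖ ^ 2 := by positivity
    rw [norm_sub_sq_real, hnorm] at h2
    linarith
  -- Pair the nonnegative one of `±(γ - γ')` with the dominant root being subtracted in it.
  rcases h.coeff_nonneg_or_nonpos hF hδ with hpos | hneg
  · have := inner_nonneg_of_coeff_nonneg hJ hF hspan hsub hpos hdom'
    rw [inner_sub_right, real_inner_self_eq_norm_sq, real_inner_comm] at this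
    linarith
  · have := inner_nonneg_of_coeff_nonneg (v := γ' - γ) hJ hF hspan
      (by rw [← neg_sub]; exact neg_mem hsub)
      (fun β => by
        rw [← neg_sub γ γ', map_neg, Finsupp.neg_apply]
        exact neg_nonneg.mpr (hneg β)) hdom
    rw [inner_sub_right, real_inner_self_eq_norm_sq, hnorm] at this
    linarith

/-! ### Parabolic orbits -/

theorem refl_mem_rootsWithCoeffs {Φ B : Set V} (hΦ : IsRootSystem Φ) (h : IsSimpleSystem Φ B)
    {Δ : Set V} (hΔ : Δ ⊆ B) {c : Δ → ℝ} {l : ℝ} {α γ : V} (hα : α ∈ B \ Δ)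
    (hγ : γ ∈ rootsWithCoeffs h hΔ c l) : refl α γ ∈ rootsWithCoeffs h hΔ c l := by
  obtain ⟨F, hF, -, hroot⟩ := h.exists_coeff
  obtain ⟨hΦγ, hl, hcγ⟩ := hγ
  refine ⟨hΦ.refl_mem α (h.subset hα.1) γ hΦγ, (norm_refl α γ).trans hl, fun β => ?_⟩
  have hne : (⟨β, hΔ β.2⟩ : B) ≠ ⟨α, hα.1⟩ := fun heq =>
    hα.2 (by rw [← show (β : V) = α from congrArg Subtype.val heq]; exact β.2)
  -- Reflecting in `α` alters only the coefficient at `α`, which lies outside `Δ`.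
  have hcoeff : F (refl α γ) ⟨β, hΔ β.2⟩ = F γ ⟨β, hΔ β.2⟩ := by
    rw [refl_apply, map_sub, map_smul, hF ⟨α, hα.1⟩, Finsupp.sub_apply,
      Finsupp.smul_apply, Finsupp.single_eq_of_ne hne, smul_zero, sub_zero]
  rw [← hcγ β, hroot, hroot]
  exact hcoeff

theorem reflGroup_le_stabilizer_rootsWithCoeffs {Φ B : Set V} (hΦ : IsRootSystem Φ)
    (h : IsSimpleSystem Φ B) {Δ : Set V} (hΔ : Δ ⊆ B) (c : Δ → ℝ) (l : ℝ) :
    reflGroup (B \ Δ) ≤ MulAction.stabilizer (V ≃ₗ[ℝ] V) (rootsWithCoeffs h hΔ c l) := by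
  refine (Subgroup.closure_le _).mpr ?_
  rintro _ ⟨α, hα, rfl⟩
  -- By finiteness one inclusion suffices, and it holds because reflections are involutions.
  refine (MulAction.mem_stabilizer_set_iff_subset_smul_set
    (hΦ.finite.subset (rootsWithCoeffs_subset h hΔ c l))).mpr fun γ hγ => ?_
  refine ⟨refl α γ, refl_mem_rootsWithCoeffs hΦ h hΔ hα hγ, ?_⟩
  exact Submodule.reflection_reflection _ γ

/-- An orbit of a standard parabolic subgroup that is contained in a finite set meets the closed
fundamental chamber. -/
theorem IsSimpleSystem.exists_mem_orbit_mem_chamber {Φ B : Set V} (h : IsSimpleSystem Φ B)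
    {J : Set V} (hJ : J ⊆ B) {X : Set V} (hX : X.Finite)
    (γ : V) (hγ : MulAction.orbit (reflGroup J) γ ⊆ X) :
    ∃ δ ∈ MulAction.orbit (reflGroup J) γ, δ ∈ chamber J := by
  obtain ⟨F, hF, -, -⟩ := h.exists_coeff
  -- The height, i.e. the sum of coefficients. Reflecting `δ` in a simple root `α` with `⟪δ, α⟫ < 0`
  -- raises it, so a maximiser is dominant.
  let ht : V →ₗ[ℝ] ℝ := Finsupp.linearCombination ℝ (fun _ : B => (1 : ℝ)) ∘ₗ F
  obtain ⟨δ, hδ, hmax⟩ := Set.exists_max_image _ ht (hX.subset hγ)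
    ⟨γ, MulAction.mem_orbit_self γ⟩
  refine ⟨δ, hδ, fun α hα => ?_⟩
  by_contra! hneg
  have hα0 : α ≠ 0 := by
    rintro rfl
    simp at hneg
  have hself : 0 < ⟪α, α⟫ := real_inner_self_pos.mpr hα0
  have hmem : refl α δ ∈ MulAction.orbit (reflGroup J) γ :=
    MulAction.mem_orbit_of_mem_orbit
      (⟨refl α, Subgroup.subset_closure ⟨α, hα, rfl⟩⟩ : reflGroup J) hδ
  have hle := hmax _ hmem
  have hht : ht α = 1 := by
    simp [ht, hF ⟨α, hJ hα⟩]
  rw [refl_apply, map_sub, map_smul, hht, smul_eq_mul, mul_one] at hle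
  have : 2 * ⟪δ, α⟫ / ⟪α, α⟫ < 0 := div_neg_of_neg_of_pos (by linarith) hself
  linarith

end EuclideanRoots

theorem lemma1p1 {V : Type*} [NormedAddCommGroup V] [InnerProductSpace ℝ V]
    [FiniteDimensional ℝ V] (Φ B : Set V)
    (hΦ : EuclideanRoots.IsRootSystem Φ) (hcrys : EuclideanRoots.IsCrystallographic Φ)
    (hB : EuclideanRoots.IsSimpleSystem Φ B)
    (hirr : EuclideanRoots.IsIrreducibleSystem B)
    (Δ : Set V) (hΔ : Δ ⊆ B) (c : Δ → ℝ) (hc : ∃ β : Δ, c β ≠ 0) (l : ℝ) :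
    ((EuclideanRoots.rootsWithCoeffs hB hΔ c l).Nonempty →
      ∃ γ ∈ Φ, EuclideanRoots.rootsWithCoeffs hB hΔ c l =
        MulAction.orbit (EuclideanRoots.reflGroup (B \ Δ)) γ) ∧
    (EuclideanRoots.rootsWithCoeffs hB hΔ c l ∩
      EuclideanRoots.chamber (B \ Δ)).encard ≤ 1 := by
  open EuclideanRoots in
  have huniq {γ γ' : V} (hγ : γ ∈ rootsWithCoeffs hB hΔ c l ∩ chamber (B \ Δ))
      (hγ' : γ' ∈ rootsWithCoeffs hB hΔ c l ∩ chamber (B \ Δ)) : γ = γ' :=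
    eq_of_mem_rootsWithCoeffs_of_mem_chamber hΦ hcrys hB hΔ hc hγ.1 hγ'.1 hγ.2 hγ'.2
  refine ⟨fun ⟨γ, hγ⟩ => ?_, Set.encard_le_one_iff.mpr fun _ _ hγ hγ' => huniq hγ hγ'⟩
  have horbit {x : V} (hx : x ∈ EuclideanRoots.rootsWithCoeffs hB hΔ c l) :
      MulAction.orbit (EuclideanRoots.reflGroup (B \ Δ)) x ⊆
        EuclideanRoots.rootsWithCoeffs hB hΔ c l := by
    rintro _ ⟨w, rfl⟩
    have hw : (w : V ≃ₗ[ℝ] V) • EuclideanRoots.rootsWithCoeffs hB hΔ c l = _ :=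
      EuclideanRoots.reflGroup_le_stabilizer_rootsWithCoeffs hΦ hB hΔ c l w.2
    rw [← hw]
    exact Set.smul_mem_smul_set hx
  have hdom {x : V} (hx : x ∈ EuclideanRoots.rootsWithCoeffs hB hΔ c l) :=
    hB.exists_mem_orbit_mem_chamber Set.sdiff_subset
      (hΦ.finite.subset (EuclideanRoots.rootsWithCoeffs_subset hB hΔ c l)) x (horbit hx)
  refine ⟨γ, hγ.1, Set.Subset.antisymm (fun x hx => ?_) (horbit hγ)⟩
  obtain ⟨δ, hδ, hδC⟩ := hdom hγ
  obtain ⟨ε, hε, hεC⟩ := hdom hx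
  -- The two orbits share their dominant root, hence coincide.
  obtain rfl : δ = ε := huniq ⟨horbit hγ hδ, hδC⟩ ⟨horbit hx hε, hεC⟩
  rw [← MulAction.orbit_eq_iff.mpr hδ, MulAction.orbit_eq_iff.mpr hε]
  exact MulAction.mem_orbit_self x
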